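/- For $a\in(-1,1)$ let $\sigma_a:\mathbb{R}\to\mathbb{R}$ be given by $\sigma_a(x)=x$ if $x\ge 0$ and $\sigma_a(x)=ax$ if $x<0$. A fully connected network of depth $L\ge 1$ with widths $n_0=d_{in},n_1,\dots,n_{L-1},n_L=d_{out}$ and parameters $\mathbf{W}=(W_1,b_1,\dots,W_L,b_L)$, where $W_\ell\in\mathbb{R}^{n_\ell\times n_{\ell-1}}$ and $b_\ell\in\mathbb{R}^{n_\ell}$, computes the function $f_{\mathbf{W}}:\mathbb{R}^{d_{in}}\to\mathbb{R}^{d_{out}}$, $f_{\mathbf{W}}(x)=W_L\alpha_{L-1}(x)+b_L$, where $\alpha_0(x)=x$ and $\alpha_\ell(x)=\sigma_a\big(W_\ell\alpha_{\ell-1}(x)+b_\ell\big)$ for $1\le\ell\le L-1$, with $\sigma_a$ applied entrywise. A function $f:\mathbb{R}^{d_{in}}\to\mathbb{R}^{d_{out}}$ is called (finite) piecewise linear if $\mathbb{R}^{d_{in}}$ is the union of finitely many polyhedra (solution sets of finite systems of non-strict affine inequalities) on each of which $f$ agrees with an affine map; such a function is automatically continuous. **Corollary.** Let $a\in(-1,1)$.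 For any depth $L\ge\lceil\log_2(d_{in}+1)\rceil+1$ and any piecewise linear function $f:\mathbb{R}^{d_{in}}\to\mathbb{R}^{d_{out}}$, there are (positive) hidden widths $n_1,\dots,n_{L-1}$ and parameters $\mathbf{W}$ of a depth-$L$ network with nonlinearity $\sigma_a$ such that $f_{\mathbf{W}}=f$ on all of $\mathbb{R}^{d_{in}}$. -/

import Mathlib

open scoped Matrix

/-- The nonlinearity `σ_a`: the identity on `[0, ∞)` and multiplication by `a` on `(-∞, 0)`. -/
noncomputable def sigmaA (a x : ℝ) : ℝ :=
  if 0 ≤ x then x else a * x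

/-- The weights and biases `(W₁, b₁, …, W_L, b_L)` of a fully connected network with input
dimension `d`, list of hidden widths `[n₁, …, n_{L-1}]` and output dimension `e`.
The depth `L` (number of affine layers) is the length of the list of hidden widths plus one. -/
inductive NetParams : ℕ → List ℕ → ℕ → Type
  /-- No hidden layer: the only layer is the (affine) output layer. -/
  | output {d e : ℕ} (W : Matrix (Fin e) (Fin d) ℝ) (b : Fin e → ℝ) : NetParams d [] e
  /-- A first hidden layer with `m` neurons, followed by the remaining layers. -/
  | hidden {d m e : ℕ} {ns : List ℕ} (W : Matrix (Fin m) (Fin d) ℝ) (b : Fin m → ℝ)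
      (rest : NetParams m ns e) : NetParams d (m :: ns) e

/-- The network function: every layer applies `x ↦ W x + b`, the nonlinearity `σ` is applied
entrywise after every layer except the last one (the output is the last pre-activation). -/
def NetParams.toFun (σ : ℝ → ℝ) {d e : ℕ} {ns : List ℕ} :
    NetParams d ns e → (Fin d → ℝ) → (Fin e → ℝ)
  | .output W b, x => W *ᵥ x + b
  | .hidden W b rest, x => rest.toFun σ (fun i => σ ((W *ᵥ x + b) i))

/-- A (closed, convex, possibly unbounded) polyhedron in `ℝ^d`: the solution set of a finite
system of non-strict affine inequalities. -/
def IsPolyhedron {d : ℕ} (P : Set (Fin d → ℝ)) : Prop :=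
  ∃ (m : ℕ) (A : Matrix (Fin m) (Fin d) ℝ) (c : Fin m → ℝ), P = {x | ∀ i, (A *ᵥ x) i ≤ c i}

/-- Piecewise linear functions with finitely many linear regions: `ℝ^d` is the union of finitely
many polyhedra, on each of which `f` agrees with an affine map. Such functions are automatically
continuous, since the polyhedra are closed. -/
def IsPiecewiseLinear {d e : ℕ} (f : (Fin d → ℝ) → (Fin e → ℝ)) : Prop :=
  ∃ S : Set (Set (Fin d → ℝ)), S.Finite ∧ (∀ P ∈ S, IsPolyhedron P) ∧ ⋃₀ S = Set.univ ∧
    ∀ P ∈ S, ∃ (A : Matrix (Fin e) (Fin d) ℝ) (b : Fin e → ℝ), ∀ x ∈ P, f x = A *ᵥ x + b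

/-!
The maxima of affine functions form a sup-closed additive monoid `M`, so `M - M` is a lattice, and a
continuous selection `f` of finitely many affine functions lies in the lattice they generate: on the
way from `x` to `y` one of them passes from above `f` to below `f`, hence `f` is a maximum of minima
of them. By Radon's theorem applied to the linear parts, any `d + 2` affine functions on `ℝ^d` split
into two groups such that everywhere a member of the second lies below a member of the first; the
maxima of the first group together with a varying part of the second then satisfy an
inclusion–exclusion identity, which expresses every maximum linearly through maxima of at most
`d + 1` affine functions. Finally, `max x y = y + max (x - y) 0` costs one hidden layer, since both
`x` and `max x 0` are linear combinations of `σ_a x` and `σ_a (-x)` when `|a| ≠ 1`, so maxima of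
`2 ^ k` affine functions are computed by a tournament with `k` hidden layers.
-/

open scoped Pointwise

section LatticeOrderedGroup

variable {G : Type*} [Lattice G] [AddCommGroup G] [IsOrderedAddMonoid G]

/-- The finite suprema of elements of an additive submonoid of a lattice-ordered group, as an
additive submonoid. For the affine functions, these are the maxima of affine functions. -/
def supClosureAddSubmonoid (A : AddSubmonoid G) : AddSubmonoid G where
  carrier := supClosure A
  zero_mem' := subset_supClosure A.zero_mem
  add_mem' := by
    have add_mem_of_mem_left {a g : G} (ha : a ∈ A) (hg : g ∈ supClosure (A : Set G)) :
        a + g ∈ supClosure (A : Set G) := by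
      refine supClosure_min (t := {g | a + g ∈ supClosure (A : Set G)})
        (fun b hb => subset_supClosure (A.add_mem ha hb)) (fun b hb c hc => ?_) hg
      simpa only [Set.mem_ofPred_eq, add_sup] using supClosed_supClosure hb hc
    intro f g hf hg
    refine supClosure_min (t := {f | f + g ∈ supClosure (A : Set G)})
      (fun a ha => add_mem_of_mem_left ha hg) (fun b hb c hc => ?_) hf
    simpa only [Set.mem_ofPred_eq, sup_add] using supClosed_supClosure hb hc

theorem isSublattice_sub {M : AddSubmonoid G} (hM : SupClosed (M : Set G)) :
    IsSublattice ((M : Set G) - (M : Set G)) := by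
  have supClosed_sub : SupClosed ((M : Set G) - (M : Set G)) := by
    rintro _ ⟨g₁, hg₁, h₁, hh₁, rfl⟩ _ ⟨g₂, hg₂, h₂, hh₂, rfl⟩
    refine ⟨(g₁ + h₂) ⊔ (g₂ + h₁), hM (M.add_mem hg₁ hh₂) (M.add_mem hg₂ hh₁),
      h₁ + h₂, M.add_mem hh₁ hh₂, ?_⟩
    dsimp only
    rw [sup_sub, add_sub_add_right_eq_sub, add_comm h₁ h₂, add_sub_add_right_eq_sub]
  refine ⟨supClosed_sub, fun f hf g hg => ?_⟩
  rw [← Set.neg_mem_neg, neg_sub, neg_inf]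
  rw [← Set.neg_mem_neg, neg_sub] at hf hg
  exact supClosed_sub hf hg

end LatticeOrderedGroup

section Selection

theorem mem_latticeClosure_of_forall_exists_le_le {X R ι : Type*} [Nonempty X] [Lattice R]
    [Finite ι] {f : X → R} {l : ι → X → R} (h : ∀ x y, ∃ i, f x ≤ l i x ∧ l i y ≤ f y) :
    f ∈ latticeClosure (Set.range l) := by
  classical
  cases nonempty_fintype ι
  let above (x : X) : Finset ι := {i | f x ≤ l i x}
  have mem_above {x : X} {i : ι} : i ∈ above x ↔ f x ≤ l i x := by simp [above]
  have above_nonempty (x : X) : (above x).Nonempty :=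
    (h x x).imp fun i hi => mem_above.2 hi.1
  cases nonempty_fintype (Set.range above)
  let rep : Set.range above → X := Set.rangeSplitting above
  have max_min : f = Finset.univ.sup' Finset.univ_nonempty
      fun T => (above (rep T)).inf' (above_nonempty (rep T)) l := by
    ext y
    rw [Finset.sup'_apply]
    refine le_antisymm ?_ (Finset.sup'_le _ _ fun T _ => ?_)
    · refine le_trans ?_ (Finset.le_sup' _ (Finset.mem_univ ⟨above y, y, rfl⟩))
      rw [Finset.inf'_apply]
      refine Finset.le_inf' _ _ fun i hi => mem_above.1 ?_
      rwa [Set.apply_rangeSplitting above] at hi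
    · obtain ⟨i, hi, hiy⟩ := h (rep T) y
      rw [Finset.inf'_apply]
      exact (Finset.inf'_le _ (mem_above.2 hi)).trans hiy
  rw [max_min]
  exact isSublattice_latticeClosure.supClosed.finsetSup'_mem _ fun T _ =>
    isSublattice_latticeClosure.infClosed.finsetInf'_mem _ fun i _ =>
      subset_latticeClosure ⟨i, rfl⟩

theorem eventually_forall_eq_of_eq {X Y ι : Type*} [TopologicalSpace X] [TopologicalSpace Y]
    [T2Space Y] [Finite ι] {f : X → Y} {l : ι → X → Y} {x : X} (hf : ContinuousAt f x)
    (hl : ∀ i, ContinuousAt (l i) x) : ∀ᶠ y in nhds x, ∀ i, f y = l i y → f x = l i x := by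
  refine Filter.eventually_all.2 fun i => ?_
  by_cases hx : f x = l i x
  · exact Filter.Eventually.of_forall fun _ _ => hx
  · filter_upwards [(hf.ne_iff_eventually_ne (hl i)).1 hx] with y hy heq using absurd heq hy

theorem affineMap_le_of_le_of_lt {𝕜 : Type*} [Field 𝕜] [LinearOrder 𝕜] [IsStrictOrderedRing 𝕜]
    {l m : 𝕜 →ᵃ[𝕜] 𝕜} {r t s : 𝕜} (hrt : r ≤ t) (hts : t ≤ s) (ht : l t ≤ m t)
    (hs : m s < l s) : l r ≤ m r := by
  by_contra! hr
  have hconv : Convex 𝕜 ((l - m) ⁻¹' Set.Ioi 0) := (convex_Ioi 0).affine_preimage (l - m)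
  have hmem := hconv.ordConnected.out (x := r) (y := s) (by simpa using hr) (by simpa using hs)
    ⟨hrt, hts⟩
  exact ht.not_gt (by simpa using hmem)

theorem exists_le_affineMap_left_and_affineMap_le_right {ι : Type*} [Finite ι] {g : ℝ → ℝ}
    (hg : Continuous g) {l : ι → ℝ →ᵃ[ℝ] ℝ} (hsel : ∀ t, ∃ i, g t = l i t) {a b : ℝ}
    (hab : a ≤ b) : ∃ i, g a ≤ l i a ∧ l i b ≤ g b := by
  have hl (i : ι) : Continuous (l i) := (l i).continuous_of_finiteDimensional
  let Q : Set ℝ := {t | ∃ i, g a ≤ l i a ∧ l i t ≤ g t}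
  have hclosed : IsClosed Q := by
    simp only [Q, Set.ofPred_exists]
    exact isClosed_iUnion_of_finite fun i => isClosed_const.inter (isClosed_le (hl i) hg)
  have hleft : a ∈ Q := (hsel a).imp fun i hi => ⟨hi.le, hi.ge⟩
  have hright : ∀ t ∈ Q ∩ Set.Ico a b, Q ∈ nhdsWithin t (Set.Ioi t) := by
    rintro t ⟨⟨i, hia, hit⟩, hat, -⟩
    filter_upwards [nhdsWithin_le_nhds
      (eventually_forall_eq_of_eq hg.continuousAt fun i => (hl i).continuousAt),
      self_mem_nhdsWithin] with s hactive hts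
    obtain ⟨j, hj⟩ := hsel s
    rcases le_or_gt (l i s) (g s) with his | his
    · exact ⟨i, hia, his⟩
    -- `l i` overtakes `l j` between `t` and `s`, so it starts below `l j`.
    · have hija : l i a ≤ l j a := affineMap_le_of_le_of_lt hat (Set.mem_Ioi.1 hts).le
        (hit.trans_eq (hactive j hj)) (hj ▸ his)
      exact ⟨j, hia.trans hija, hj.ge⟩
  exact (hclosed.inter isClosed_Icc).Icc_subset_of_forall_mem_nhdsWithin hleft hright
    (Set.right_mem_Icc.2 hab)

theorem mem_latticeClosure_of_continuous_selection {E ι : Type*} [AddCommGroup E] [Module ℝ E]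
    [TopologicalSpace E] [IsTopologicalAddGroup E] [ContinuousSMul ℝ E] [Finite ι] {f : E → ℝ}
    (hf : Continuous f) {l : ι → E →ᵃ[ℝ] ℝ} (hsel : ∀ x, ∃ i, f x = l i x) :
    f ∈ latticeClosure (Set.range fun i => ⇑(l i)) := by
  refine mem_latticeClosure_of_forall_exists_le_le fun x y => ?_
  simpa using exists_le_affineMap_left_and_affineMap_le_right
    (g := fun t => f (AffineMap.lineMap x y t)) (hf.comp AffineMap.lineMap_continuous)
    (l := fun i => (l i).comp (AffineMap.lineMap x y)) (fun t => hsel _) zero_le_one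

end Selection

section Maxima

theorem sum_powerset_neg_one_pow_mul_sup'_eq_zero {ι R : Type*} [DecidableEq ι] [CommRing R]
    [LinearOrder R] {P N : Finset ι} (hP : P.Nonempty) (f : ι → R)
    (h : ∃ j ∈ N, ∃ i ∈ P, f j ≤ f i) :
    ∑ T ∈ N.powerset, (-1) ^ T.card * (P ∪ T).sup' (hP.mono Finset.subset_union_left) f = 0 := by
  obtain ⟨j, hj, i, hi, hji⟩ := h
  -- The terms of `T` and `insert j T` cancel.
  rw [← Finset.insert_erase hj, Finset.sum_powerset_insert (Finset.notMem_erase j N),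
    ← Finset.sum_add_distrib]
  refine Finset.sum_eq_zero fun T hT => ?_
  have hjT : j ∉ T := fun hjT => Finset.notMem_erase j N (Finset.mem_powerset.1 hT hjT)
  have hji' : f j ≤ (P ∪ T).sup' (hP.mono Finset.subset_union_left) f :=
    hji.trans (Finset.le_sup' f (Finset.mem_union_left T hi))
  simp only [Finset.union_insert, Finset.sup'_insert (hP.mono Finset.subset_union_left),
    sup_eq_right.2 hji', Finset.card_insert_of_notMem hjT]
  ring

variable {E : Type*} [AddCommGroup E] [Module ℝ E]

variable (E) in
/-- The affine functions on `E`, as a subspace of the space of all real functions on `E`. -/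
def affineFunctions : Submodule ℝ (E → ℝ) where
  carrier := Set.range fun l : E →ᵃ[ℝ] ℝ => ⇑l
  add_mem' := by
    rintro _ _ ⟨l, rfl⟩ ⟨m, rfl⟩
    exact ⟨l + m, rfl⟩
  zero_mem' := ⟨0, rfl⟩
  smul_mem' := by
    rintro c _ ⟨l, rfl⟩
    exact ⟨c • l, rfl⟩

variable (E) in
/-- The maxima of at least one and at most `n` affine functions on `E`. -/
def affineMaxima (n : ℕ) : Set (E → ℝ) :=
  {g | ∃ (s : Finset (E →ᵃ[ℝ] ℝ)) (hs : s.Nonempty), s.card ≤ n ∧ g = s.sup' hs (⇑·)}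

theorem exists_le_and_exists_ge_of_mem_convexHull {S : Set (E →ᵃ[ℝ] ℝ)} {g : E →ᵃ[ℝ] ℝ}
    (hg : g ∈ convexHull ℝ S) (x : E) : (∃ l ∈ S, l x ≤ g x) ∧ ∃ l ∈ S, g x ≤ l x := by
  let evalAt : (E →ᵃ[ℝ] ℝ) →ₗ[ℝ] ℝ :=
    { toFun := fun l => l x, map_add' := fun _ _ => rfl, map_smul' := fun _ _ => rfl }
  exact ⟨(evalAt.concaveOn convex_univ).exists_le_of_mem_convexHull (Set.subset_univ S) hg,
    (evalAt.convexOn convex_univ).exists_ge_of_mem_convexHull (Set.subset_univ S) hg⟩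

variable [FiniteDimensional ℝ E]

open Module (finrank)

theorem exists_set_forall_exists_affineMap_le {ι : Type*} [Fintype ι] (l : ι → E →ᵃ[ℝ] ℝ)
    (hcard : finrank ℝ E + 1 < Fintype.card ι) :
    ∃ I : Set ι, ∀ x, ∃ j ∈ Iᶜ, ∃ i ∈ I, l j x ≤ l i x := by
  let linearPart : (E →ᵃ[ℝ] ℝ) →ₗ[ℝ] Module.Dual ℝ E :=
    LinearMap.snd ℝ ℝ _ ∘ₗ (AffineMap.toConstProdLinearMap ℝ).toLinearMap
  have hdep : ¬ AffineIndependent ℝ (linearPart ∘ l) := fun hind => by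
    have hspan := Submodule.finrank_le (vectorSpan ℝ (Set.range (linearPart ∘ l)))
    rw [Subspace.dual_finrank_eq] at hspan
    have := hind.card_le_finrank_succ
    omega
  obtain ⟨I, p, hpI, hpIc⟩ := Convex.radon_partition hdep
  rw [Set.image_comp, ← LinearMap.image_convexHull] at hpI hpIc
  obtain ⟨g, hg, rfl⟩ := hpI
  obtain ⟨h, hh, hhg⟩ := hpIc
  have hconst (x : E) : h x - h 0 = g x - g 0 := by
    have : h.linear x = g.linear x := congrArg (· x) hhg
    simpa [AffineMap.decomp'] using this
  rcases le_total (h 0) (g 0) with h0 | h0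
  · refine ⟨I, fun x => ?_⟩
    obtain ⟨-, _, ⟨i, hi, rfl⟩, hgi⟩ := exists_le_and_exists_ge_of_mem_convexHull hg x
    obtain ⟨⟨_, ⟨j, hj, rfl⟩, hjh⟩, -⟩ := exists_le_and_exists_ge_of_mem_convexHull hh x
    exact ⟨j, hj, i, hi, by linarith [hconst x]⟩
  · refine ⟨Iᶜ, fun x => ?_⟩
    obtain ⟨-, _, ⟨i, hi, rfl⟩, hhi⟩ := exists_le_and_exists_ge_of_mem_convexHull hh x
    obtain ⟨⟨_, ⟨j, hj, rfl⟩, hjg⟩, -⟩ := exists_le_and_exists_ge_of_mem_convexHull hg x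
    exact ⟨j, by simpa using hj, i, hi, by linarith [hconst x]⟩

theorem exists_subset_forall_exists_affineMap_le [DecidableEq (E →ᵃ[ℝ] ℝ)]
    {s : Finset (E →ᵃ[ℝ] ℝ)} (hcard : finrank ℝ E + 1 < s.card) :
    ∃ P ⊆ s, ∀ x, ∃ m ∈ s \ P, ∃ l ∈ P, m x ≤ l x := by
  classical
  obtain ⟨I, hI⟩ := exists_set_forall_exists_affineMap_le (fun l : s => (l : E →ᵃ[ℝ] ℝ))
    (by simpa using hcard)
  refine ⟨s.filter (· ∈ Subtype.val '' I), Finset.filter_subset _ _, fun x => ?_⟩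
  obtain ⟨m, hm, l, hl, hml⟩ := hI x
  exact ⟨m, by simpa using hm, l, by simpa using hl, hml⟩

theorem sup'_mem_span_affineMaxima (s : Finset (E →ᵃ[ℝ] ℝ)) (hs : s.Nonempty) :
    s.sup' hs (⇑·) ∈ Submodule.span ℝ (affineMaxima E (finrank ℝ E + 1)) := by
  classical
  induction s using Finset.strongInduction with
  | H s ih =>
    by_cases hcard : s.card ≤ finrank ℝ E + 1
    · exact Submodule.subset_span ⟨s, hs, hcard, rfl⟩
    obtain ⟨P, hPs, hdom⟩ := exists_subset_forall_exists_affineMap_le (not_le.1 hcard)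
    have hP : P.Nonempty := let ⟨_, _, l, hl, _⟩ := hdom 0; ⟨l, hl⟩
    let N := s \ P
    have hunion : P ∪ N = s := Finset.union_sdiff_of_subset hPs
    let maxWith (T : Finset (E →ᵃ[ℝ] ℝ)) : E → ℝ :=
      (P ∪ T).sup' (hP.mono Finset.subset_union_left) (⇑·)
    have halt : ∑ T ∈ N.powerset, (-1 : ℝ) ^ T.card • maxWith T = 0 := by
      ext x
      simpa [maxWith, Finset.sum_apply, Finset.sup'_apply] using
        sum_powerset_neg_one_pow_mul_sup'_eq_zero hP (· x) (hdom x)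
    have hproper : ∀ T ∈ N.powerset.erase N, (-1 : ℝ) ^ T.card • maxWith T ∈
        Submodule.span ℝ (affineMaxima E (finrank ℝ E + 1)) := by
      intro T hT
      obtain ⟨hne, hTN⟩ := Finset.mem_erase.1 hT
      rw [Finset.mem_powerset] at hTN
      obtain ⟨l, hlN, hlT⟩ := Finset.exists_of_ssubset (hTN.ssubset_of_ne hne)
      have hlP : l ∉ P := (Finset.mem_sdiff.1 hlN).2
      refine Submodule.smul_mem _ _ (ih _ ((Finset.ssubset_iff_of_subset ?_).2 ⟨l, ?_, ?_⟩) _)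
      · exact hunion ▸ Finset.union_subset_union_right hTN
      · exact (Finset.mem_sdiff.1 hlN).1
      · simp [hlP, hlT]
    rw [← Finset.sum_erase_add _ _ (Finset.mem_powerset_self N)] at halt
    have hfull := (Submodule.add_mem_iff_right _ (Submodule.sum_mem _ hproper)).1
      (halt ▸ Submodule.zero_mem _)
    simpa only [maxWith, hunion] using
      (Submodule.smul_mem_iff _ (pow_ne_zero _ (neg_ne_zero.2 one_ne_zero))).1 hfull

theorem supClosure_affineFunctions_subset_span_affineMaxima :
    supClosure (affineFunctions E : Set (E → ℝ)) ⊆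
      Submodule.span ℝ (affineMaxima E (finrank ℝ E + 1)) := by
  classical
  rintro _ ⟨t, ht, hsub, rfl⟩
  obtain ⟨s, -, rfl⟩ := Finset.subset_set_image_iff.1
    (hsub.trans_eq (Set.image_univ (f := fun l : E →ᵃ[ℝ] ℝ => ⇑l)).symm)
  simpa only [Finset.sup'_image, Function.id_comp, SetLike.mem_coe] using
    sup'_mem_span_affineMaxima s (Finset.image_nonempty.1 ht)

theorem mem_span_affineMaxima_of_continuous_selection [TopologicalSpace E]
    [IsTopologicalAddGroup E] [ContinuousSMul ℝ E] {ι : Type*} [Finite ι] {f : E → ℝ}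
    (hf : Continuous f) {l : ι → E →ᵃ[ℝ] ℝ} (hsel : ∀ x, ∃ i, f x = l i x) :
    f ∈ Submodule.span ℝ (affineMaxima E (finrank ℝ E + 1)) := by
  let M : AddSubmonoid (E → ℝ) := supClosureAddSubmonoid (affineFunctions E).toAddSubmonoid
  have hrange : (Set.range fun i => ⇑(l i)) ⊆ (M : Set (E → ℝ)) - (M : Set (E → ℝ)) := by
    rintro _ ⟨i, rfl⟩
    exact ⟨l i, subset_supClosure ⟨l i, rfl⟩, 0, M.zero_mem, sub_zero _⟩
  obtain ⟨g, hg, h, hh, rfl⟩ := latticeClosure_min hrange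
    (isSublattice_sub (M := M) supClosed_supClosure)
    (mem_latticeClosure_of_continuous_selection hf hsel)
  exact sub_mem (supClosure_affineFunctions_subset_span_affineMaxima hg)
    (supClosure_affineFunctions_subset_span_affineMaxima hh)

end Maxima

section PiecewiseLinear

variable {d e : ℕ}

theorem IsPolyhedron.isClosed {P : Set (Fin d → ℝ)} (hP : IsPolyhedron P) : IsClosed P := by
  obtain ⟨m, A, c, rfl⟩ := hP
  simp only [Set.ofPred_forall]
  exact isClosed_iInter fun i => isClosed_le (by fun_prop) continuous_const

variable {f : (Fin d → ℝ) → (Fin e → ℝ)}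

theorem IsPiecewiseLinear.continuous (hf : IsPiecewiseLinear f) : Continuous f := by
  obtain ⟨S, hfin, hpoly, hcover, haff⟩ := hf
  have := hfin.to_subtype
  refine (locallyFinite_of_finite fun P : S => P.1).continuous
    (Set.sUnion_eq_iUnion ▸ hcover) (fun P => (hpoly P P.2).isClosed) fun P => ?_
  obtain ⟨A, b, hAb⟩ := haff P P.2
  exact ContinuousOn.congr (by fun_prop) hAb

theorem IsPiecewiseLinear.apply_mem_span_affineMaxima (hf : IsPiecewiseLinear f) (j : Fin e) :
    (fun x => f x j) ∈ Submodule.span ℝ (affineMaxima (Fin d → ℝ) (d + 1)) := by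
  have hcont : Continuous fun x => f x j := (continuous_apply j).comp hf.continuous
  obtain ⟨S, hfin, -, hcover, haff⟩ := hf
  have := hfin.to_subtype
  choose A b hAb using fun P : S => haff P P.2
  let piece (P : S) : (Fin d → ℝ) →ᵃ[ℝ] ℝ :=
    (LinearMap.proj j ∘ₗ (A P).mulVecLin).toAffineMap + AffineMap.const ℝ _ (b P j)
  have hsel (x : Fin d → ℝ) : ∃ P, f x j = piece P x := by
    obtain ⟨P, hP, hx⟩ := Set.mem_sUnion.1 (hcover ▸ Set.mem_univ x)
    exact ⟨⟨P, hP⟩, congrFun (hAb ⟨P, hP⟩ x hx) j⟩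
  simpa using mem_span_affineMaxima_of_continuous_selection hcont hsel

end PiecewiseLinear

section Layers

theorem sup'_mem_of_card_le_two_pow {α ι : Type*} [SemilatticeSup α] {V : ℕ → Set α}
    (hV : ∀ k, ∀ a ∈ V k, ∀ b ∈ V k, a ⊔ b ∈ V (k + 1)) {s : Finset ι} (hs : s.Nonempty)
    {f : ι → α} (hf : ∀ i ∈ s, f i ∈ V 0) {k : ℕ} (hcard : s.card ≤ 2 ^ k) :
    s.sup' hs f ∈ V k := by
  classical
  induction k generalizing s with
  | zero =>
    obtain ⟨i, rfl⟩ := Finset.card_eq_one.1 (le_antisymm hcard hs.card_pos)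
    simpa using hf
  | succ k ih =>
    by_cases hk : s.card ≤ 2 ^ k
    · simpa using hV k _ (ih hs hf hk) _ (ih hs hf hk)
    · obtain ⟨t, hts, htcard⟩ := Finset.exists_subset_card_eq (not_le.1 hk).le
      have hrest : (s \ t).card = s.card - 2 ^ k := by
        rw [Finset.card_sdiff_of_subset hts, htcard]
      have ht : t.Nonempty := Finset.card_pos.1 (htcard ▸ by positivity)
      have hst : (s \ t).Nonempty := Finset.card_pos.1 (by omega)
      have hsup := hV k _ (ih ht (fun i hi => hf i (hts hi)) htcard.le) _
        (ih hst (fun i hi => hf i (Finset.sdiff_subset hi)) (by rw [pow_succ] at hcard; omega))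
      rw [← Finset.sup'_union ht hst] at hsup
      simpa only [Finset.union_sdiff_of_subset hts] using hsup

variable {X : Type*} {a : ℝ} {V : Submodule ℝ (X → ℝ)} {f g : X → ℝ}

/-- The functions computed by adding one hidden layer with nonlinearity `σ` to functions in `V`:
the linear combinations of the functions `σ ∘ f` with `f ∈ V`. There is no bias: the constants the
construction needs already occur among the affine functions to which the first layer is added. -/
def nextLayer (σ : ℝ → ℝ) (V : Submodule ℝ (X → ℝ)) : Submodule ℝ (X → ℝ) :=
  Submodule.span ℝ ((σ ∘ ·) '' (V : Set (X → ℝ)))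

theorem comp_mem_nextLayer (σ : ℝ → ℝ) (hf : f ∈ V) : σ ∘ f ∈ nextLayer σ V :=
  Submodule.subset_span ⟨f, hf, rfl⟩

theorem sigmaA_of_nonneg (a : ℝ) {x : ℝ} (hx : 0 ≤ x) : sigmaA a x = x :=
  if_pos hx

theorem sigmaA_of_nonpos (a : ℝ) {x : ℝ} (hx : x ≤ 0) : sigmaA a x = a * x := by
  rcases hx.lt_or_eq with hx | rfl
  · exact if_neg hx.not_ge
  · simp [sigmaA]

theorem sigmaA_sub_sigmaA_neg (a x : ℝ) : sigmaA a x - sigmaA a (-x) = (1 + a) * x := by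
  rcases le_total 0 x with hx | hx
  · rw [sigmaA_of_nonneg a hx, sigmaA_of_nonpos a (neg_nonpos.2 hx)]
    ring
  · rw [sigmaA_of_nonpos a hx, sigmaA_of_nonneg a (neg_nonneg.2 hx)]
    ring

theorem sigmaA_add_mul_sigmaA_neg (a x : ℝ) :
    sigmaA a x + a * sigmaA a (-x) = (1 - a ^ 2) * max x 0 := by
  rcases le_total 0 x with hx | hx
  · rw [sigmaA_of_nonneg a hx, sigmaA_of_nonpos a (neg_nonpos.2 hx), max_eq_left hx]
    ring
  · rw [sigmaA_of_nonpos a hx, sigmaA_of_nonneg a (neg_nonneg.2 hx), max_eq_right hx]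
    ring

theorem le_nextLayer_sigmaA (ha : a ≠ -1) (V : Submodule ℝ (X → ℝ)) :
    V ≤ nextLayer (sigmaA a) V := by
  intro f hf
  have hsub : (1 + a) • f = sigmaA a ∘ f - sigmaA a ∘ (-f) :=
    funext fun x => (sigmaA_sub_sigmaA_neg a (f x)).symm
  have ha' : 1 + a ≠ 0 := fun h => ha (eq_neg_of_add_eq_zero_right h)
  refine (Submodule.smul_mem_iff _ ha').1 (hsub ▸ sub_mem ?_ ?_)
  · exact comp_mem_nextLayer _ hf
  · exact comp_mem_nextLayer _ (neg_mem hf)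

theorem sup_mem_nextLayer_sigmaA (ha : |a| ≠ 1) (hf : f ∈ V) (hg : g ∈ V) :
    f ⊔ g ∈ nextLayer (sigmaA a) V := by
  have ha_sq : 1 - a ^ 2 ≠ 0 := by
    rw [sub_ne_zero, ← one_pow 2, ne_eq, sq_eq_sq_iff_abs_eq_abs, abs_one]
    exact ha.symm
  have hrelu : (1 - a ^ 2) • ((f - g) ⊔ 0) =
      sigmaA a ∘ (f - g) + a • (sigmaA a ∘ (-(f - g))) :=
    funext fun x => (sigmaA_add_mul_sigmaA_neg a (f x - g x)).symm
  have hmem : (f - g) ⊔ 0 ∈ nextLayer (sigmaA a) V := by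
    refine (Submodule.smul_mem_iff _ ha_sq).1 (hrelu ▸ add_mem ?_ (Submodule.smul_mem _ a ?_))
    · exact comp_mem_nextLayer _ (sub_mem hf hg)
    · exact comp_mem_nextLayer _ (neg_mem (sub_mem hf hg))
  have ha_neg : a ≠ -1 := by
    rintro rfl
    simp at ha
  have hsup : f ⊔ g = (f - g) ⊔ 0 + g := by rw [sup_add, sub_add_cancel, zero_add]
  exact hsup ▸ add_mem hmem (le_nextLayer_sigmaA ha_neg V hg)

theorem span_affineMaxima_le_iterate_nextLayer {E : Type*} [AddCommGroup E] [Module ℝ E]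
    (ha : |a| ≠ 1) {n k : ℕ} (hn : n ≤ 2 ^ k) :
    Submodule.span ℝ (affineMaxima E n) ≤ (nextLayer (sigmaA a))^[k] (affineFunctions E) := by
  rw [Submodule.span_le]
  rintro _ ⟨s, hs, hcard, rfl⟩
  refine sup'_mem_of_card_le_two_pow
    (V := fun k => ((nextLayer (sigmaA a))^[k] (affineFunctions E) : Set (E → ℝ)))
    (fun k f hf g hg => ?_) hs (fun l _ => ⟨l, rfl⟩) (hcard.trans hn)
  rw [Function.iterate_succ_apply']
  exact sup_mem_nextLayer_sigmaA ha hf hg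

end Layers

section Networks

/-- Append an output layer to a network: its former output layer becomes the last hidden layer. -/
def NetParams.snoc {d m e : ℕ} {ns : List ℕ} (V : Matrix (Fin e) (Fin m) ℝ) (c : Fin e → ℝ) :
    NetParams d ns m → NetParams d (ns ++ [m]) e
  | .output W b => .hidden W b (.output V c)
  | .hidden W b rest => .hidden W b (rest.snoc V c)

theorem NetParams.toFun_snoc (σ : ℝ → ℝ) {d m e : ℕ} {ns : List ℕ}
    (V : Matrix (Fin e) (Fin m) ℝ) (c : Fin e → ℝ) (W : NetParams d ns m) (x : Fin d → ℝ) :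
    (W.snoc V c).toFun σ x = V *ᵥ (σ ∘ W.toFun σ x) + c := by
  induction W with
  | output W b => rfl
  | hidden W b _ ih => exact ih V _

theorem exists_matrix_of_forall_mem_span {R M κ : Type*} [Semiring R] [AddCommMonoid M]
    [Module R M] [Finite κ] {S : Set M} (hS : S.Nonempty) {f : κ → M}
    (hf : ∀ j, f j ∈ Submodule.span R S) :
    ∃ (m : ℕ) (g : Fin m → M) (A : Matrix κ (Fin m) R), 0 < m ∧ (∀ i, g i ∈ S) ∧
      ∀ j, f j = ∑ i, A j i • g i := by
  classical
  cases nonempty_fintype κ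
  obtain ⟨u, hu⟩ := hS
  choose c hcS hcf using fun j => Submodule.mem_span_set.1 (hf j)
  let U : Finset M := insert u (Finset.univ.biUnion fun j => (c j).support)
  have hUS : ∀ v ∈ U, v ∈ S := by
    intro v hv
    rcases Finset.mem_insert.1 hv with rfl | hv
    · exact hu
    · obtain ⟨j, -, hj⟩ := Finset.mem_biUnion.1 hv
      exact hcS j hj
  have hsupp (j : κ) : (c j).support ⊆ U :=
    (Finset.subset_biUnion_of_mem (fun j => (c j).support) (Finset.mem_univ j)).trans
      (Finset.subset_insert _ _)
  refine ⟨U.card, fun i => U.equivFin.symm i, fun j i => c j (U.equivFin.symm i),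
    Finset.card_pos.2 (Finset.insert_nonempty _ _), fun i => hUS _ (U.equivFin.symm i).2,
    fun j => ?_⟩
  calc f j = ∑ v ∈ U, c j v • v := by
        rw [← hcf j, Finsupp.sum_of_support_subset _ (hsupp j) _ (by simp)]
    _ = ∑ v : U, c j v • (v : M) := (Finset.sum_coe_sort U fun v => c j v • v).symm
    _ = ∑ i, c j (U.equivFin.symm i) • (U.equivFin.symm i : M) :=
        (U.equivFin.symm.sum_comp fun v => c j v • (v : M)).symm

theorem exists_netParams_output_of_mem_affineFunctions (σ : ℝ → ℝ) {d e : ℕ}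
    {f : (Fin d → ℝ) → (Fin e → ℝ)} (hf : ∀ j, (fun x => f x j) ∈ affineFunctions (Fin d → ℝ)) :
    ∃ W : NetParams d [] e, W.toFun σ = f := by
  choose l hl using hf
  let A : (Fin d → ℝ) →ᵃ[ℝ] (Fin e → ℝ) := AffineMap.pi l
  refine ⟨.output (LinearMap.toMatrix' A.linear) (A 0), ?_⟩
  have hA : ⇑A = f := funext fun x => funext fun j => congrFun (hl j) x
  rw [← hA, A.decomp]
  ext x : 1
  simp [NetParams.toFun]

theorem exists_netParams_of_mem_iterate_nextLayer (σ : ℝ → ℝ) {d k e : ℕ}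
    {f : (Fin d → ℝ) → (Fin e → ℝ)}
    (hf : ∀ j, (fun x => f x j) ∈ (nextLayer σ)^[k] (affineFunctions (Fin d → ℝ))) :
    ∃ ns : List ℕ, ns.length = k ∧ (∀ m ∈ ns, 0 < m) ∧
      ∃ W : NetParams d ns e, W.toFun σ = f := by
  induction k generalizing e with
  | zero => exact ⟨[], rfl, by simp, exists_netParams_output_of_mem_affineFunctions σ hf⟩
  | succ k ih =>
    simp only [Function.iterate_succ_apply'] at hf
    obtain ⟨m, g, V, hm, hg, hV⟩ := exists_matrix_of_forall_mem_span
      (Set.Nonempty.image _ ⟨0, Submodule.zero_mem _⟩) hf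
    choose h hh hhg using hg
    obtain ⟨ns, hlen, hpos, W, hW⟩ := ih (f := fun x i => h i x) hh
    refine ⟨ns ++ [m], by simp [hlen], by simpa [or_imp, forall_and, hm] using hpos,
      W.snoc V 0, ?_⟩
    ext x j
    have hVx : f x j = ∑ i, V j i * g i x := by simpa using congrFun (hV j) x
    simp [NetParams.toFun_snoc, hW, hVx, ← hhg, Matrix.mulVec, dotProduct]

end Networks

theorem mainTheorem9_general (a : ℝ) (ha : |a| ≠ 1) (d_in d_out L : ℕ)
    (hL : ⌈Real.logb 2 ((d_in : ℝ) + 1)⌉₊ + 1 ≤ L)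
    (f : (Fin d_in → ℝ) → (Fin d_out → ℝ)) (hf : IsPiecewiseLinear f) :
    ∃ ns : List ℕ, ns.length + 1 = L ∧ (∀ m ∈ ns, 0 < m) ∧
      ∃ W : NetParams d_in ns d_out, W.toFun (sigmaA a) = f := by
  obtain ⟨k, rfl⟩ : ∃ k, L = k + 1 := ⟨L - 1, by omega⟩
  have hd : d_in + 1 ≤ 2 ^ k := by
    have hclog := Real.natCeil_logb_natCast 2 (d_in + 1)
    push_cast at hclog
    exact (Nat.clog_le_iff_le_pow one_lt_two).1 (by omega)
  obtain ⟨ns, hlen, hns⟩ := exists_netParams_of_mem_iterate_nextLayer (sigmaA a) fun j =>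
    span_affineMaxima_le_iterate_nextLayer ha hd (hf.apply_mem_span_affineMaxima j)
  exact ⟨ns, congrArg (· + 1) hlen, hns⟩

theorem mainTheorem9 (a : ℝ) (ha : a ∈ Set.Ioo (-1 : ℝ) 1) (d_in d_out L : ℕ)
    (hL : ⌈Real.logb 2 ((d_in : ℝ) + 1)⌉₊ + 1 ≤ L)
    (f : (Fin d_in → ℝ) → (Fin d_out → ℝ)) (hf : IsPiecewiseLinear f) :
    ∃ ns : List ℕ, ns.length + 1 = L ∧ (∀ m ∈ ns, 0 < m) ∧
      ∃ W : NetParams d_in ns d_out, W.toFun (sigmaA a) = f :=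
  mainTheorem9_general a (abs_lt.2 ha).ne d_in d_out L hL f hf
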